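/- Let $T$ be a locally finite tree (possibly with leaves) with vertex set $V(T)$ and edge set $E(T)$, rooted at a vertex $o$ having exactly one neighbour. For an edge $\alpha$ let $b(\alpha)$ and $e(\alpha)$ be its endpoints closest to and farthest from $o$, let $|\alpha|$ be the distance from $o$ to $b(\alpha)$, and write $\beta\ge\alpha$ if the geodesic from $o$ to $e(\beta)$ contains $\alpha$. The boundary $\partial T$ consists of all half-infinite geodesics starting at $o$ together with the leaves of $T$ other than $o$. For $x\in V(T)\cup\partial T$ let $P(x)$ be the set of edges of the geodesic from $o$ to $x$; let $\partial T_\alpha=\{\zeta\in\partial T:\alpha\in P(\zeta)\}$, and give $\partial T$ the topology generated by the sets $\partial T_\alpha$, $\alpha\in E(T)$. Measures on $\partial T$ are finite positive Borel measures. Fix $1<p<\infty$ and let $1/p+1/p'=1$. For $f:E(T)\to\mathbb R$ put $f_p=\operatorname{sgn}(f)|f|^{p'-1}$ and $f_{p'}=\operatorname{sgn}(f)|f|^{p-1}$, and $If(x)=\sum_{\alpha\in P(x)}f(\alpha)$ for $x\in V(T)$, and also for $x\in\partial T$ if $f\ge0$ (the value $+\infty$ is allowed). For a measure $\mu$ let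 $I^*\mu(\alpha)=\mu(\partial T_\alpha)$. For $E\subseteq\partial T$ let $\Omega_E=\{f\in\ell^p(E(T)): f\ge0,\ If\ge1\text{ on }E\}$ and $c_p(E)=\inf_{f\in\Omega_E}\|f\|_p^p$. A measure $\mu$ is the $p$-equilibrium measure of $E$ if $\mu$ is carried by $\overline E$, the function $f=(I^*\mu)_p$ is the $p$-equilibrium function of $E$ (that is, $f$ lies in the $\ell^p$-closure of $\Omega_E$ and $\|f\|_p^p=c_p(E)$), $If\ge1$ on $E$ outside a set of zero $p$-capacity, and $\mu(\partial T)=c_p(E)$. A function $f:E(T)\to\mathbb R$ is forward additive if for every edge $\alpha$ one has $f(\alpha)=\sum f(\beta)$, the sum being over the edges $\beta$ that share a vertex with $\alpha$ and have $|\beta|=|\alpha|+1$. (a) Let $M:E(T)\to\mathbb R$ satisfy $I(M_p)<1$ on $V(T)$ and, for every $\alpha\in E(T)$ (the series being convergent), $$M(\alpha)\bigl(1-I(M_p)(b(\alpha))\bigr)=\sum_{\beta\ge\alpha}|M(\beta)|^{p'}.$$ Then $M$ is forward additive, and there are a measure $\mu$ on $\partial T$ with $M=I^*\mu$ and an $\mathcal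 F_\sigma$ set $E\subseteq\partial T$ such that $\mu$ is the $p$-equilibrium measure of $E$. (b) For $g:V(T)\to\mathbb R$ write $\nabla g(\alpha)=g(e(\alpha))-g(b(\alpha))$. Let $g$ satisfy $g(o)=0$, $g<1$ on $V(T)$ and, for every $\alpha\in E(T)$ (the series being convergent), $$(\nabla g)_{p'}(\alpha)\bigl(1-g(b(\alpha))\bigr)=\sum_{\beta\ge\alpha}|\nabla g(\beta)|^{p}.$$ Then $g$ is $p$-harmonic, that is, $\sum_{y\sim x}\operatorname{sgn}(g(y)-g(x))|g(y)-g(x)|^{p-1}=0$ for every vertex $x\ne o$, and there are a measure $\mu$ on $\partial T$ with $(\nabla g)_{p'}=I^*\mu$ and an $\mathcal F_\sigma$ set $E\subseteq\partial T$ such that $\mu$ is the $p$-equilibrium measure of $E$. -/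

import Mathlib

open MeasureTheory Set
open scoped ENNReal

namespace RootedTree

variable {V : Type*} (G : SimpleGraph V) (o : V)

noncomputable section

/-! ### Edges of a tree rooted at `o` -/

/-- The beginning `b(α)` of an edge: its endpoint closest to the root. -/
def beg (α : G.edgeSet) : V :=
  if G.dist o (Quot.out (α : Sym2 V)).1 ≤ G.dist o (Quot.out (α : Sym2 V)).2 then
    (Quot.out (α : Sym2 V)).1 else (Quot.out (α : Sym2 V)).2

/-- The end `e(α)` of an edge: its endpoint farthest from the root. -/
def fin (α : G.edgeSet) : V :=
  if G.dist o (Quot.out (α : Sym2 V)).1 ≤ G.dist o (Quot.out (α : Sym2 V)).2 then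
    (Quot.out (α : Sym2 V)).2 else (Quot.out (α : Sym2 V)).1

theorem mk_beg_fin (α : G.edgeSet) : s(beg G o α, fin G o α) = (α : Sym2 V) := by
  have h : s((Quot.out (α : Sym2 V)).1, (Quot.out (α : Sym2 V)).2) = (α : Sym2 V) :=
    Quot.out_eq (α : Sym2 V)
  unfold beg fin
  split_ifs
  · exact h
  · rw [Sym2.eq_swap]; exact h

theorem adj_beg_fin (α : G.edgeSet) : G.Adj (beg G o α) (fin G o α) := by
  rw [← SimpleGraph.mem_edgeSet, mk_beg_fin]
  exact α.2

theorem dist_fin (hG : G.IsTree) (α : G.edgeSet) :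
    G.dist o (fin G o α) = G.dist o (beg G o α) + 1 := by
  have h1 := hG.dist_eq_dist_add_one_of_adj o (adj_beg_fin G o α)
  have h2 : G.dist o (beg G o α) ≤ G.dist o (fin G o α) := by
    unfold beg fin
    split_ifs <;> omega
  omega

/-- The level `|α|`: the number of edges preceding `α`. -/
def level (α : G.edgeSet) : ℕ := G.dist o (beg G o α)

/-- The predecessor set `P(x)` of a vertex: the edges of the geodesic from the root to `x`. -/
def pred (x : V) : Set G.edgeSet :=
  {α | ∃ w : G.Walk o x, w.IsPath ∧ (α : Sym2 V) ∈ w.edges}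

theorem pred_finite (hG : G.IsTree) (x : V) : (pred G o x).Finite := by
  obtain ⟨w, hw, huniq⟩ := hG.existsUnique_path o x
  refine Set.Finite.of_finite_image (f := Subtype.val) ?_ Subtype.val_injective.injOn
  refine (List.finite_toSet w.edges).subset ?_
  rintro _ ⟨α, ⟨w', hw', hα⟩, rfl⟩
  rw [huniq w' hw'] at hα
  exact hα

/-- The edges of the tent `T_α`: all `β ≥ α`, that is, those `β` such that the geodesic from the
root which ends with `β` passes through `α`. -/
def tentEdges (α : G.edgeSet) : Set G.edgeSet := {β | α ∈ pred G o (fin G o β)}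

/-- The edges following `α`: those sharing a vertex with `α`, of level `|α| + 1`. -/
def children (α : G.edgeSet) : Set G.edgeSet :=
  {β | (∃ x : V, x ∈ (α : Sym2 V) ∧ x ∈ (β : Sym2 V)) ∧ level G o β = level G o α + 1}

theorem children_finite [G.LocallyFinite] (α : G.edgeSet) : (children G o α).Finite := by
  have key : ∀ x : V, {β : G.edgeSet | x ∈ (β : Sym2 V)}.Finite := by
    intro x
    refine Set.Finite.of_finite_image (f := Subtype.val) ?_ Subtype.val_injective.injOn
    refine ((Set.toFinite (G.neighborSet x)).image (fun y => s(x, y))).subset ?_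
    rintro _ ⟨⟨e, he⟩, hx, rfl⟩
    obtain ⟨y, rfl⟩ := Sym2.mem_iff_exists.1 hx
    exact ⟨y, he, rfl⟩
  refine ((key (beg G o α)).union (key (fin G o α))).subset ?_
  rintro β ⟨⟨x, hxα, hxβ⟩, -⟩
  rw [← mk_beg_fin G o α, Sym2.mem_iff] at hxα
  rcases hxα with rfl | rfl
  · exact Or.inl hxβ
  · exact Or.inr hxβ

/-! ### The boundary -/

/-- The boundary `∂T`: the half-infinite geodesics starting at the root, together with the
leaves (the vertices other than the root which have exactly one neighbour). -/
inductive Boundary : Type _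
  | ray (γ : ℕ → V) (start : γ 0 = o) (adj : ∀ n, G.Adj (γ n) (γ (n + 1)))
      (inj : Function.Injective γ) : Boundary
  | leaf (x : V) (ne_root : x ≠ o) (deg : ∃! y, G.Adj x y) : Boundary

/-- The predecessor set `P(ζ)` of a boundary point. -/
def bpred : Boundary G o → Set G.edgeSet
  | .ray γ _ _ _ => {α | ∃ n, (α : Sym2 V) = s(γ n, γ (n + 1))}
  | .leaf x _ _ => pred G o x

/-- The boundary `∂T_α` of a tent, as a subset of `∂T`. -/
def tentBoundary (α : G.edgeSet) : Set (Boundary G o) := {ζ | α ∈ bpred G o ζ}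

/-- The topology of `∂T`, generated by the sets `∂T_α`. -/
instance : TopologicalSpace (Boundary G o) :=
  TopologicalSpace.generateFrom (Set.range (tentBoundary G o))

instance : MeasurableSpace (Boundary G o) := borel _

instance : BorelSpace (Boundary G o) := ⟨rfl⟩

/-- An `F_σ` subset of `∂T`: a countable union of closed sets. -/
def IsFSigma (E : Set (Boundary G o)) : Prop :=
  ∃ K : ℕ → Set (Boundary G o), (∀ n, IsClosed (K n)) ∧ E = ⋃ n, K n

/-! ### Potentials -/

/-- `f_p(α) = sgn f(α) |f(α)|^{p' - 1}`, where `1/p + 1/p' = 1`. -/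
def dualPow (p : ℝ) (f : G.edgeSet → ℝ) : G.edgeSet → ℝ :=
  fun α => Real.sign (f α) * |f α| ^ (p.conjExponent - 1)

/-- The potential `If(x) = ∑_{α ∈ P(x)} f(α)` at a vertex; the sum is finite. -/
def vertexPotential (f : G.edgeSet → ℝ) (x : V) : ℝ := ∑ᶠ α ∈ pred G o x, f α

/-- The potential `If(ζ) = ∑_{α ∈ P(ζ)} f(α) ∈ [0, ∞]` at a boundary point, for `f ≥ 0`. -/
def boundaryPotential (f : G.edgeSet → ℝ) (ζ : Boundary G o) : ℝ≥0∞ :=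
  ∑' α : bpred G o ζ, ENNReal.ofReal (f α)

/-- The co-potential `I^*μ(α) = μ(∂T_α)`. -/
def coPotential (μ : Measure (Boundary G o)) (α : G.edgeSet) : ℝ :=
  (μ (tentBoundary G o α)).toReal

/-! ### Capacity and equilibrium measures -/

/-- `‖f‖_p^p`, an element of `[0, ∞]`. -/
def lpPow (p : ℝ) (f : G.edgeSet → ℝ) : ℝ≥0∞ := ∑' α, ENNReal.ofReal (|f α| ^ p)

/-- `Ω_E`: the nonnegative functions in `ℓ^p` whose potential is at least `1` on `E`. -/
def Omega (p : ℝ) (E : Set (Boundary G o)) : Set (G.edgeSet → ℝ) :=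
  {f | (∀ α, 0 ≤ f α) ∧ lpPow G p f < ∞ ∧ ∀ ζ ∈ E, 1 ≤ boundaryPotential G o f ζ}

/-- The closure of `Ω_E` in the norm of `ℓ^p`. -/
def OmegaClosure (p : ℝ) (E : Set (Boundary G o)) : Set (G.edgeSet → ℝ) :=
  {f | lpPow G p f < ∞ ∧ ∀ ε : ℝ≥0∞, 0 < ε → ∃ h ∈ Omega G o p E, lpPow G p (f - h) < ε}

/-- The `p`-capacity `c_p(E) = inf {‖f‖_p^p : f ∈ Ω_E}`. -/
def capacity (p : ℝ) (E : Set (Boundary G o)) : ℝ≥0∞ :=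
  ⨅ f ∈ Omega G o p E, lpPow G p f

/-- `f` is the `p`-equilibrium function of `E`: the element of the closure of `Ω_E` with
`‖f‖_p^p = c_p(E)`. -/
def IsEquilibriumFunction (p : ℝ) (E : Set (Boundary G o)) (f : G.edgeSet → ℝ) : Prop :=
  f ∈ OmegaClosure G o p E ∧ lpPow G p f = capacity G o p E

/-- `μ` is the `p`-equilibrium measure of `E`: it is a finite measure carried by the closure of
`E`, the edge function `(I^*μ)_p` is the `p`-equilibrium function of `E`, its potential is at
least `1` on `E` but for a set of null capacity, and the total mass of `μ` is `c_p(E)`. -/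
structure IsEquilibriumMeasure (p : ℝ) (E : Set (Boundary G o))
    (μ : Measure (Boundary G o)) : Prop where
  finite : IsFiniteMeasure μ
  carried : μ (closure E)ᶜ = 0
  equilibriumFunction : IsEquilibriumFunction G o p E (dualPow G p (coPotential G o μ))
  potential_ge_one :
    capacity G o p
      {ζ ∈ E | boundaryPotential G o (dualPow G p (coPotential G o μ)) ζ < 1} = 0
  mass : μ Set.univ = capacity G o p E

/-! ### The equations -/

/-- The equilibrium equation: for every edge `α`, the series `∑_{β ≥ α} |M(β)|^{p'}` converges to
`M(α) (1 - I(M_p)(b(α)))`. -/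
def EquilibriumEquation (p : ℝ) (M : G.edgeSet → ℝ) : Prop :=
  ∀ α : G.edgeSet, HasSum (fun β : tentEdges G o α => |M β| ^ p.conjExponent)
    (M α * (1 - vertexPotential G o (dualPow G p M) (beg G o α)))

/-- `f` is forward additive: `f(α) = ∑ f(β)`, over the (finitely many) edges `β` following `α`. -/
def ForwardAdditive (f : G.edgeSet → ℝ) : Prop :=
  ∀ α : G.edgeSet, f α = ∑ᶠ β ∈ children G o α, f β

/-- The gradient `∇g(α) = g(e(α)) - g(b(α))` of a vertex function. -/
def grad (g : V → ℝ) (α : G.edgeSet) : ℝ := g (fin G o α) - g (beg G o α)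

/-- The `p`-Laplacian of a vertex function. -/
def pLaplacian [G.LocallyFinite] (p : ℝ) (g : V → ℝ) (x : V) : ℝ :=
  ∑ y ∈ G.neighborFinset x, Real.sign (g y - g x) * |g y - g x| ^ (p - 1)

/-- `g` is `p`-harmonic: its `p`-Laplacian vanishes at every vertex other than the root. -/
def PHarmonic [G.LocallyFinite] (p : ℝ) (g : V → ℝ) : Prop :=
  ∀ x : V, x ≠ o → pLaplacian G p g x = 0

/-- The equilibrium equation for a vertex function: for every edge `α`, the series
`∑_{β ≥ α} |∇g(β)|^p` converges to `(∇g)_{p'}(α) (1 - g(b(α)))`. Here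
`(∇g)_{p'} = sgn(∇g) |∇g|^{p - 1}`, as the conjugate exponent of `p'` is `p`. -/
def VertexEquilibriumEquation (p : ℝ) (g : V → ℝ) : Prop :=
  ∀ α : G.edgeSet, HasSum (fun β : tentEdges G o α => |grad G o g β| ^ p)
    (dualPow G p.conjExponent (grad G o g) α * (1 - g (beg G o α)))

end

end RootedTree

namespace RootedTree

variable {V : Type*} {G : SimpleGraph V} {o : V}

/-! ### Combinatorics of the rooted tree -/

/-! Write `f = M_p`. The series in the equation are nonnegative and `1 - If > 0` at vertices, so `M
≥ 0`. The tent of `α` is the disjoint union of `α` and the tents of its children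
(`hasSum_tentEdges`), so the equation at `α` combines with those at the children `c` into `M(α)(1 -
If(b(α))) = M(α)^{p'} + (∑ M(c))(1 - If(e(α)))`. Since `M^{p'} = M f` and `If(e(α)) = If(b(α)) +
f(α)`, this is `M(α) = ∑ M(c)` multiplied by the nonzero factor `1 - If(e(α))`: forward additivity.

A nonnegative forward additive `M` is a co-potential (`exists_measure_tentBoundary`): give each edge
a half-open interval of length `M(α)`, partitioned by the intervals of its children. A point of the
root interval selects a ray, and `μ` is the image of Lebesgue measure.

On the boundary `If ≤ 1`, as a limit of vertex potentials. By Tonelli `∫ If dμ = ∑ f M = ∑ M^{p'}`,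
which is `M(ω) = μ(∂T)` by the equation at the root edge `ω`. Hence `If = 1` almost everywhere, and
regularity gives an `F_σ` set `E` of full measure inside `{If = 1}`.

Finally `f ∈ Ω_E` has energy `∑ M^{p'} = μ(∂T)`, and no `h ∈ Ω_E` has less, by Young's inequality
applied to `μ(∂T) ≤ ∫ Ih dμ = ∑ h M` (`le_lpPow_of_one_le_boundaryPotential`). So `μ` is the
equilibrium measure.

Part (b) is part (a) for `M = (∇g)_{p'}`: then `M_p = ∇g`, `I(∇g) = g`, and forward additivity of
`M` says that `g` is `p`-harmonic. -/

theorem exists_edge_of_adj (hG : G.IsTree) {x y : V} (h : G.Adj x y)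
    (hd : G.dist o y = G.dist o x + 1) : ∃ α : G.edgeSet, beg G o α = x ∧ fin G o α = y := by
  refine ⟨⟨s(x, y), h⟩, ?_⟩
  have h1 := mk_beg_fin G o ⟨s(x, y), h⟩
  have h2 := dist_fin G o hG ⟨s(x, y), h⟩
  rcases Sym2.eq_iff.1 h1 with h3 | ⟨h3, h4⟩
  · exact h3
  · rw [h3, h4] at h2
    omega

theorem exists_fin_eq (hG : G.IsTree) {x : V} (hx : x ≠ o) : ∃ α : G.edgeSet, fin G o α = x := by
  obtain ⟨w, hw⟩ := (hG.connected x o).exists_walk_length_eq_dist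
  cases w with
  | nil => exact absurd rfl hx
  | cons h q =>
    rename_i y
    rw [SimpleGraph.Walk.length_cons, SimpleGraph.dist_comm] at hw
    have h1 := SimpleGraph.dist_le q
    rw [SimpleGraph.dist_comm] at h1
    have h2 := hG.dist_eq_dist_add_one_of_adj o h
    obtain ⟨α, -, h3⟩ := exists_edge_of_adj (o := o) hG h.symm (by omega)
    exact ⟨α, h3⟩

@[elab_as_elim]
theorem vertex_induction (hG : G.IsTree) {P : V → Prop} (h0 : P o)
    (h1 : ∀ α : G.edgeSet, P (beg G o α) → P (fin G o α)) (x : V) : P x := by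
  induction hn : G.dist o x generalizing x with
  | zero =>
    rw [hG.connected.dist_eq_zero_iff] at hn
    exact hn ▸ h0
  | succ n ih =>
    have hx : x ≠ o := by
      rintro rfl
      simp at hn
    obtain ⟨α, rfl⟩ := exists_fin_eq hG hx
    rw [dist_fin G o hG] at hn
    exact h1 α (ih _ (by omega))

theorem pred_eq (hG : G.IsTree) {x : V} {w : G.Walk o x} (hw : w.IsPath) :
    pred G o x = {α : G.edgeSet | (α : Sym2 V) ∈ w.edges} := by
  ext α
  constructor
  · rintro ⟨w', hw', h⟩
    rwa [(hG.existsUnique_path o x).unique hw' hw] at h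
  · exact fun h => ⟨w, hw, h⟩

theorem pred_root (hG : G.IsTree) : pred G o o = ∅ := by
  rw [pred_eq hG (w := SimpleGraph.Walk.nil) SimpleGraph.Walk.IsPath.nil]
  simp

theorem pred_fin (hG : G.IsTree) (α : G.edgeSet) :
    pred G o (fin G o α) = insert α (pred G o (beg G o α)) := by
  classical
  obtain ⟨w, hw, hl⟩ := hG.connected.exists_path_of_dist o (beg G o α)
  have h : fin G o α ∉ w.support := by
    intro hmem
    have h1 := SimpleGraph.dist_le (w.takeUntil _ hmem)
    have h2 := w.length_takeUntil_le_length hmem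
    have h3 := dist_fin G o hG α
    omega
  rw [pred_eq hG (hw.concat h (adj_beg_fin G o α)), pred_eq hG hw]
  ext β
  simp only [SimpleGraph.Walk.edges_concat, mk_beg_fin, List.concat_eq_append, List.mem_append,
    List.mem_singleton, mem_ofPred_eq, mem_insert_iff, Subtype.ext_iff]
  exact or_comm

theorem level_lt_of_mem_pred (hG : G.IsTree) {α : G.edgeSet} (x : V) :
    α ∈ pred G o x → level G o α < G.dist o x := by
  induction x using vertex_induction (o := o) hG with
  | h0 => simp [pred_root hG]
  | h1 β ih =>
    rw [pred_fin hG, dist_fin G o hG]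
    rintro (rfl | h)
    · exact Nat.lt_succ_self _
    · exact (ih h).trans (Nat.lt_succ_self _)

theorem not_mem_pred_beg (hG : G.IsTree) (α : G.edgeSet) : α ∉ pred G o (beg G o α) :=
  fun h => (level_lt_of_mem_pred hG _ h).false

/-- Two distinct edges with a common end would each precede the other, so each would have the
smaller level. -/
theorem fin_injective (hG : G.IsTree) : Function.Injective (fin G o) := by
  intro α β h
  by_contra hne
  have h1 : α ∈ pred G o (fin G o β) := by
    rw [← h, pred_fin hG]
    exact mem_insert _ _
  have h2 : β ∈ pred G o (fin G o α) := by
    rw [h, pred_fin hG]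
    exact mem_insert _ _
  rw [pred_fin hG] at h1 h2
  have h3 := level_lt_of_mem_pred hG _ (h1.resolve_left hne)
  have h4 := level_lt_of_mem_pred hG _ (h2.resolve_left (Ne.symm hne))
  exact lt_asymm h3 h4

theorem eq_of_mem_pred_of_level_eq (hG : G.IsTree) {α β : G.edgeSet}
    (hl : level G o α = level G o β) (x : V) :
    α ∈ pred G o x → β ∈ pred G o x → α = β := by
  induction x using vertex_induction (o := o) hG with
  | h0 => simp [pred_root hG]
  | h1 γ ih =>
    rw [pred_fin hG]
    rintro (rfl | h1) (rfl | h2)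
    · rfl
    · exact absurd (level_lt_of_mem_pred hG _ h2) (by rw [← hl]; exact lt_irrefl _)
    · exact absurd (level_lt_of_mem_pred hG _ h1) (by rw [hl]; exact lt_irrefl _)
    · exact ih h1 h2

theorem pred_fin_subset (hG : G.IsTree) {α : G.edgeSet} (x : V) :
    α ∈ pred G o x → pred G o (fin G o α) ⊆ pred G o x := by
  induction x using vertex_induction (o := o) hG with
  | h0 => simp [pred_root hG]
  | h1 β ih =>
    intro h
    rw [pred_fin hG β] at h ⊢
    rcases h with rfl | h
    · rw [pred_fin hG]
    · exact (ih h).trans (subset_insert _ _)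

theorem mem_children_iff (hG : G.IsTree) {α β : G.edgeSet} :
    β ∈ children G o α ↔ beg G o β = fin G o α := by
  have ha := dist_fin G o hG α
  have hb := dist_fin G o hG β
  constructor
  · rintro ⟨⟨x, hxα, hxβ⟩, hl⟩
    rw [← mk_beg_fin G o α, Sym2.mem_iff] at hxα
    rw [← mk_beg_fin G o β, Sym2.mem_iff] at hxβ
    unfold level at hl
    rcases hxα with h1 | h1 <;> rcases hxβ with h2 | h2
    · rw [← h1, ← h2] at hl
      omega
    · rw [← h1] at hl
      rw [← h2] at hb
      omega
    · rw [← h1, ← h2]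
    · rw [← h1] at ha
      rw [← h2] at hb
      omega
  · intro h
    refine ⟨⟨fin G o α, ?_, ?_⟩, ?_⟩
    · rw [← mk_beg_fin G o α]
      exact Sym2.mem_mk_right _ _
    · rw [← mk_beg_fin G o β, h]
      exact Sym2.mem_mk_left _ _
    · rw [level, h, ha, level]

theorem eq_fin_or_exists_child (hG : G.IsTree) {α : G.edgeSet} (x : V) :
    α ∈ pred G o x → x = fin G o α ∨ ∃ c ∈ children G o α, c ∈ pred G o x := by
  induction x using vertex_induction (o := o) hG with
  | h0 => simp [pred_root hG]
  | h1 β ih =>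
    rw [pred_fin hG β]
    rintro (rfl | h)
    · exact Or.inl rfl
    · rcases ih h with h1 | ⟨c, hc, h1⟩
      · exact Or.inr ⟨β, (mem_children_iff hG).2 h1, mem_insert _ _⟩
      · exact Or.inr ⟨c, hc, mem_insert_of_mem _ h1⟩

theorem mem_pred_fin_self (hG : G.IsTree) (α : G.edgeSet) : α ∈ pred G o (fin G o α) := by
  rw [pred_fin hG]
  exact mem_insert _ _

theorem exists_parent (hG : G.IsTree) {β : G.edgeSet} (h : level G o β ≠ 0) :
    ∃ α, β ∈ children G o α := by
  obtain ⟨α, hα⟩ := exists_fin_eq (G := G) (o := o) hG (x := beg G o β) (by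
    rintro h1
    rw [level, h1, SimpleGraph.dist_self] at h
    exact h rfl)
  exact ⟨α, (mem_children_iff hG).2 hα.symm⟩

theorem mem_tentEdges_iff (hG : G.IsTree) {α β : G.edgeSet} :
    β ∈ tentEdges G o α ↔ β = α ∨ ∃ c ∈ children G o α, β ∈ tentEdges G o c := by
  constructor
  · intro h
    exact (eq_fin_or_exists_child hG _ h).imp_left fun h1 => fin_injective hG h1
  · rintro (rfl | ⟨c, hc, h⟩)
    · exact mem_pred_fin_self hG _
    · refine pred_fin_subset hG _ h ?_
      rw [pred_fin hG, (mem_children_iff hG).1 hc]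
      exact mem_insert_of_mem _ (mem_pred_fin_self hG _)

/-- The tent of `α` splits into `α` and the tents of its finitely many children. These are disjoint
because a geodesic from the root has only one edge of each level. -/
theorem hasSum_tentEdges [G.LocallyFinite] (hG : G.IsTree) {α : G.edgeSet} {F S : G.edgeSet → ℝ}
    (h : ∀ c ∈ children G o α, HasSum (fun β : tentEdges G o c => F β) (S c)) :
    HasSum (fun β : tentEdges G o α => F β) (F α + ∑ᶠ c ∈ children G o α, S c) := by
  classical
  have hfin := children_finite G o α
  rw [finsum_mem_eq_finite_toFinset_sum _ hfin]
  have key : indicator (tentEdges G o α) F = fun β => (indicator {α} F β +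
      ∑ c ∈ hfin.toFinset, indicator (tentEdges G o c) F β) := by
    ext β
    have lev : ∀ c ∈ children G o α, level G o c = level G o α + 1 := fun c hc => hc.2
    by_cases hβ : β = α
    · subst hβ
      rw [indicator_of_mem (show β ∈ tentEdges G o β from mem_pred_fin_self hG β), indicator_of_mem (mem_singleton β),
        Finset.sum_eq_zero, add_zero]
      intro c hc
      refine indicator_of_notMem (fun h1 => ?_) _
      have h2 := level_lt_of_mem_pred hG _ h1
      rw [dist_fin G o hG, lev c (hfin.mem_toFinset.1 hc), level] at h2
      omega
    · rw [indicator_of_notMem (s := {α}) (by simpa using hβ), zero_add]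
      by_cases h1 : β ∈ tentEdges G o α
      · obtain ⟨c, hc, h2⟩ := ((mem_tentEdges_iff hG).1 h1).resolve_left hβ
        rw [indicator_of_mem h1, Finset.sum_eq_single c, indicator_of_mem h2]
        · intro d hd hdc
          refine indicator_of_notMem (fun h3 => hdc ?_) _
          rw [hfin.mem_toFinset] at hd
          exact eq_of_mem_pred_of_level_eq hG ((lev d hd).trans (lev c hc).symm) _ h3 h2
        · exact fun h3 => absurd (hfin.mem_toFinset.2 hc) h3
      · rw [indicator_of_notMem h1, Finset.sum_eq_zero]
        intro c hc
        exact indicator_of_notMem (fun h2 => h1 ((mem_tentEdges_iff hG).2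
          (Or.inr ⟨c, hfin.mem_toFinset.1 hc, h2⟩))) _
  have h1 := hasSum_subtype_iff_indicator (s := tentEdges G o α) (f := F)
    (a := F α + ∑ c ∈ hfin.toFinset, S c)
  refine h1.2 ?_
  rw [key]
  refine HasSum.add ?_ (hasSum_sum fun c hc => ?_)
  · convert hasSum_single (f := indicator {α} F) α fun β hβ =>
      indicator_of_notMem (by simpa using hβ) _
    simp
  · exact hasSum_subtype_iff_indicator.1 (h c (hfin.mem_toFinset.1 hc))

theorem vertexPotential_root (hG : G.IsTree) (f : G.edgeSet → ℝ) :
    vertexPotential G o f o = 0 := by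
  simp [vertexPotential, pred_root hG]

theorem vertexPotential_fin (hG : G.IsTree) (f : G.edgeSet → ℝ) (α : G.edgeSet) :
    vertexPotential G o f (fin G o α) = vertexPotential G o f (beg G o α) + f α := by
  rw [vertexPotential, pred_fin hG,
    finsum_mem_insert _ (not_mem_pred_beg hG α) (pred_finite G o hG _), add_comm]
  rfl

theorem exists_rootEdge (hG : G.IsTree) (ho : ∃! y, G.Adj o y) :
    ∃ ω : G.edgeSet, beg G o ω = o ∧ ∀ α, beg G o α = o → α = ω := by
  obtain ⟨y, hy, hu⟩ := ho
  obtain ⟨ω, h1, h2⟩ := exists_edge_of_adj (o := o) hG hy (by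
    rw [SimpleGraph.dist_self, zero_add, SimpleGraph.dist_eq_one_iff_adj]
    exact hy)
  refine ⟨ω, h1, fun α hα => fin_injective (o := o) hG ?_⟩
  rw [h2]
  apply hu
  have := adj_beg_fin G o α
  rwa [hα] at this

/-! ### Consequences of having a single edge at the root -/

section RootEdge

variable {ω : G.edgeSet}

theorem eq_rootEdge (hG : G.IsTree) (hω : ∀ α, beg G o α = o → α = ω) {α : G.edgeSet}
    (h : level G o α = 0) : α = ω := by
  rw [level, hG.connected.dist_eq_zero_iff] at h
  exact hω α h.symm

theorem rootEdge_mem_pred (hG : G.IsTree) (hω : ∀ α, beg G o α = o → α = ω) (x : V) :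
    x ≠ o → ω ∈ pred G o x := by
  refine vertex_induction hG (fun h => absurd rfl h) (fun α ih _ => ?_) x
  rw [pred_fin hG]
  by_cases h : beg G o α = o
  · exact Or.inl (hω α h).symm
  · exact Or.inr (ih h)

theorem fin_ne_root (hG : G.IsTree) (α : G.edgeSet) : fin G o α ≠ o := by
  intro h
  have := dist_fin G o hG α
  rw [h, SimpleGraph.dist_self] at this
  omega

theorem tentEdges_rootEdge (hG : G.IsTree) (hω : ∀ α, beg G o α = o → α = ω) :
    tentEdges G o ω = univ :=
  eq_univ_of_forall fun β => rootEdge_mem_pred hG hω _ (fin_ne_root hG β)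

theorem countable_edgeSet [G.LocallyFinite] (hG : G.IsTree)
    (hω : ∀ α, beg G o α = o → α = ω) : Countable G.edgeSet := by
  have h : ∀ n, {α : G.edgeSet | level G o α = n}.Finite := by
    intro n
    induction n with
    | zero => exact (finite_singleton ω).subset fun α h => eq_rootEdge hG hω h
    | succ n ih =>
      refine (ih.biUnion fun α _ => children_finite G o α).subset fun β hβ => ?_
      rw [mem_ofPred_eq] at hβ
      obtain ⟨α, hα⟩ := exists_parent (o := o) hG (β := β) (by omega)
      exact mem_biUnion (show level G o α = n by have := hα.2; omega) hα
  have h2 : (univ : Set G.edgeSet) = ⋃ n, {α | level G o α = n} := by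
    ext α
    simp
  exact countable_univ_iff.1 (h2 ▸ countable_iUnion fun n => (h n).countable)

end RootEdge

/-! ### The boundary -/

theorem dist_ray (hG : G.IsTree) {γ : ℕ → V} (start : γ 0 = o)
    (adj : ∀ n, G.Adj (γ n) (γ (n + 1))) (inj : Function.Injective γ) (n : ℕ) :
    G.dist o (γ n) = n := by
  suffices h : G.dist o (γ n) = n ∧ G.dist o (γ (n + 1)) = n + 1 from h.1
  induction n with
  | zero =>
    have h1 := adj 0
    rw [start] at h1 ⊢
    exact ⟨SimpleGraph.dist_self, SimpleGraph.dist_eq_one_iff_adj.2 h1⟩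
  | succ n ih =>
    refine ⟨ih.2, ?_⟩
    rcases hG.dist_eq_dist_add_one_of_adj o (adj (n + 1)) with h | h
    · obtain ⟨α, ha, hα⟩ := exists_edge_of_adj (o := o) hG (adj n) (by omega)
      obtain ⟨β, hb, hβ⟩ := exists_edge_of_adj (o := o) hG (adj (n + 1)).symm h
      have h1 := fin_injective hG (hα.trans hβ.symm)
      rw [h1, hb] at ha
      have := inj ha
      omega
    · omega

theorem exists_rayEdge (hG : G.IsTree) {γ : ℕ → V} (start : γ 0 = o)
    (adj : ∀ n, G.Adj (γ n) (γ (n + 1))) (inj : Function.Injective γ) (n : ℕ) :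
    ∃ α : G.edgeSet, beg G o α = γ n ∧ fin G o α = γ (n + 1) :=
  exists_edge_of_adj hG (adj n) (by simp only [dist_ray hG start adj inj])

/-- Along a ray the predecessor sets increase, so finitely many edges lie below one vertex. This
transfers statements about finitely many edges from vertices to boundary points. -/
theorem exists_subset_pred (hG : G.IsTree) (ζ : Boundary G o) {s : Set G.edgeSet}
    (hs : s.Finite) (h : s ⊆ bpred G o ζ) : ∃ x, s ⊆ pred G o x := by
  cases ζ with
  | leaf x ne_root deg => exact ⟨x, h⟩
  | ray γ start adj inj =>
    have mono : Monotone fun n => pred G o (γ n) := by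
      refine monotone_nat_of_le_succ fun n => ?_
      obtain ⟨α, h1, h2⟩ := exists_rayEdge hG start adj inj n
      simp only [← h1, ← h2, pred_fin hG]
      exact subset_insert _ _
    have hsub : s ⊆ ⋃ n, pred G o (γ n) := by
      intro α hα
      obtain ⟨n, hn⟩ := h hα
      obtain ⟨β, h1, h2⟩ := exists_rayEdge hG start adj inj n
      rw [← h1, ← h2, mk_beg_fin] at hn
      rw [Subtype.ext hn]
      refine mem_iUnion.2 ⟨n + 1, ?_⟩
      rw [← h2]
      exact mem_pred_fin_self hG β
    obtain ⟨n, hn⟩ := mono.directed_le.exists_mem_subset_of_finset_subset_biUnion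
      (s := hs.toFinset) (by simpa using hsub)
    exact ⟨γ n, by simpa using hn⟩

theorem rootEdge_mem_bpred (hG : G.IsTree) {ω : G.edgeSet}
    (hω : ∀ α, beg G o α = o → α = ω) (ζ : Boundary G o) : ω ∈ bpred G o ζ := by
  cases ζ with
  | leaf x ne_root deg => exact rootEdge_mem_pred hG hω x ne_root
  | ray γ start adj inj =>
    obtain ⟨α, h1, h2⟩ := exists_rayEdge hG start adj inj 0
    refine ⟨0, ?_⟩
    rw [← h1, ← h2, mk_beg_fin, hω α (h1.trans start)]

theorem tentBoundary_rootEdge (hG : G.IsTree) {ω : G.edgeSet}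
    (hω : ∀ α, beg G o α = o → α = ω) : tentBoundary G o ω = univ :=
  eq_univ_of_forall fun ζ => rootEdge_mem_bpred hG hω ζ

theorem isOpen_tentBoundary (α : G.edgeSet) : IsOpen (tentBoundary G o α) :=
  TopologicalSpace.isOpen_generateFrom_of_mem (mem_range_self α)

/-- A point outside the tent has an edge `β` in its predecessor set that no geodesic from the root
shares with `α`: the last edge for a leaf, which nothing follows, and the edge of level `|α|` for a
ray. -/
theorem isClosed_tentBoundary (hG : G.IsTree) (α : G.edgeSet) :
    IsClosed (tentBoundary G o α) := by
  rw [← isOpen_compl_iff, isOpen_iff_forall_mem_open]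
  intro ζ hζ
  suffices h : ∃ β, β ∈ bpred G o ζ ∧ ∀ y, β ∈ pred G o y → α ∉ pred G o y by
    obtain ⟨β, h1, h2⟩ := h
    refine ⟨tentBoundary G o β, fun ζ' hβ hα => ?_, isOpen_tentBoundary β, h1⟩
    obtain ⟨y, hy⟩ := exists_subset_pred hG ζ' (s := {α, β}) (by simp)
      (insert_subset hα (singleton_subset_iff.2 hβ))
    exact h2 y (hy (by simp)) (hy (by simp))
  cases ζ with
  | leaf x ne_root deg =>
    obtain ⟨β, rfl⟩ := exists_fin_eq hG ne_root
    refine ⟨β, mem_pred_fin_self hG β, fun y hy hα => ?_⟩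
    rcases eq_fin_or_exists_child hG y hy with rfl | ⟨c, hc, -⟩
    · exact hζ hα
    · have h1 := adj_beg_fin G o c
      have h2 := dist_fin G o hG c
      have h3 := dist_fin G o hG β
      rw [(mem_children_iff hG).1 hc] at h1 h2
      have h4 := deg.unique h1 (adj_beg_fin G o β).symm
      rw [h4] at h2
      omega
  | ray γ start adj inj =>
    obtain ⟨β, h1, h2⟩ := exists_rayEdge hG start adj inj (level G o α)
    have hβ : β ∈ bpred G o (.ray γ start adj inj) := ⟨level G o α, by rw [← h1, ← h2, mk_beg_fin]⟩
    refine ⟨β, hβ, fun y hy hα => hζ ?_⟩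
    rw [eq_of_mem_pred_of_level_eq hG (β := β) ?_ y hα hy]
    · exact hβ
    · rw [level, level, h1, dist_ray hG start adj inj, level]

theorem secondCountable_boundary [Countable G.edgeSet] :
    SecondCountableTopology (Boundary G o) :=
  ⟨⟨range (tentBoundary G o), countable_range _, rfl⟩⟩

/-- The tents are clopen, so recording membership in each of them induces the topology from a
countable power of `Bool`. This supplies the inner regularity by closed sets used to find `E`. -/
theorem pseudoMetrizable_boundary (hG : G.IsTree) [Countable G.edgeSet] :
    TopologicalSpace.PseudoMetrizableSpace (Boundary G o) := by
  classical
  let f : Boundary G o → G.edgeSet → Bool := fun ζ α => decide (α ∈ bpred G o ζ)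
  have hf : Topology.IsInducing f := by
    refine ⟨le_antisymm ?_ ?_⟩
    · rw [← continuous_iff_le_induced]
      refine continuous_pi fun α => ?_
      rw [continuous_bool_rng true]
      have : (fun ζ => f ζ α) ⁻¹' {true} = tentBoundary G o α := by
        ext ζ
        simp [f, tentBoundary]
      rw [this]
      exact ⟨isClosed_tentBoundary hG α, isOpen_tentBoundary α⟩
    · refine le_generateFrom ?_
      rintro _ ⟨α, rfl⟩
      refine isOpen_induced_iff.2 ⟨{g | g α = true}, ?_, ?_⟩
      · exact (isOpen_discrete ({true} : Set Bool)).preimage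
          (continuous_apply (A := fun _ : G.edgeSet => Bool) α)
      · ext ζ
        simp [f, tentBoundary]
  exact hf.pseudoMetrizableSpace

/-! ### The measure with a given forward additive co-potential -/

/-- The intervals are laid end to end from `L`; being half-open, they cover without overlap. -/
theorem exists_partition_Ico {ι : Type*} (S : Finset ι) {M : ι → ℝ} (hM : ∀ i, 0 ≤ M i) (L : ℝ) :
    ∃ a : ι → ℝ, (∀ c ∈ S, Ico (a c) (a c + M c) ⊆ Ico L (L + ∑ i ∈ S, M i)) ∧
      (∀ t ∈ Ico L (L + ∑ i ∈ S, M i), ∃ c ∈ S, t ∈ Ico (a c) (a c + M c)) ∧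
      ∀ t, ∀ c ∈ S, ∀ d ∈ S, t ∈ Ico (a c) (a c + M c) → t ∈ Ico (a d) (a d + M d) → c = d := by
  classical
  induction S using Finset.induction_on with
  | empty => exact ⟨0, by simp⟩
  | insert x S hx ih =>
    obtain ⟨a, h1, h2, h3⟩ := ih
    have hS : 0 ≤ ∑ i ∈ S, M i := Finset.sum_nonneg fun i _ => hM i
    have hxM := hM x
    have hold : ∀ c ∈ S, Function.update a x (L + ∑ i ∈ S, M i) c = a c := fun c hc =>
      Function.update_of_ne (ne_of_mem_of_not_mem hc hx) _ _
    have hdisj : ∀ t, ∀ c ∈ S, t ∈ Ico (a c) (a c + M c) → ¬ L + ∑ i ∈ S, M i ≤ t :=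
      fun t c hc ht => not_le.2 (h1 c hc ht).2
    refine ⟨Function.update a x (L + ∑ i ∈ S, M i), ?_, ?_, ?_⟩
    · intro c hc
      rw [Finset.sum_insert hx]
      rcases Finset.mem_insert.1 hc with rfl | hc
      · rw [Function.update_self]
        exact Ico_subset_Ico (by linarith) (by linarith)
      · rw [hold c hc]
        exact (h1 c hc).trans (Ico_subset_Ico le_rfl (by linarith))
    · rintro t ⟨ht1, ht2⟩
      rw [Finset.sum_insert hx] at ht2
      by_cases ht : t < L + ∑ i ∈ S, M i
      · obtain ⟨c, hc, h⟩ := h2 t ⟨ht1, ht⟩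
        exact ⟨c, Finset.mem_insert_of_mem hc, by rwa [hold c hc]⟩
      · refine ⟨x, Finset.mem_insert_self _ _, ?_⟩
        rw [Function.update_self]
        exact ⟨not_lt.1 ht, by linarith⟩
    · intro t c hc d hd htc htd
      rcases Finset.mem_insert.1 hc with rfl | hc' <;> rcases Finset.mem_insert.1 hd with rfl | hd'
      · rfl
      · rw [hold d hd'] at htd
        rw [Function.update_self] at htc
        exact absurd htc.1 (hdisj t d hd' htd)
      · rw [hold c hc'] at htc
        rw [Function.update_self] at htd
        exact absurd htd.1 (hdisj t c hc' htc)
      · rw [hold c hc'] at htc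
        rw [hold d hd'] at htd
        exact h3 t c hc' d hd' htc htd

theorem exists_nested_Ico [G.LocallyFinite] (hG : G.IsTree) {M : G.edgeSet → ℝ}
    (hM : ∀ α, 0 ≤ M α) (hadd : ForwardAdditive G o M) :
    ∃ a : G.edgeSet → ℝ, ∀ α,
      (∀ c ∈ children G o α, Ico (a c) (a c + M c) ⊆ Ico (a α) (a α + M α)) ∧
      (∀ t ∈ Ico (a α) (a α + M α), ∃ c ∈ children G o α, t ∈ Ico (a c) (a c + M c)) ∧
      ∀ t, ∀ c ∈ children G o α, ∀ d ∈ children G o α,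
        t ∈ Ico (a c) (a c + M c) → t ∈ Ico (a d) (a d + M d) → c = d := by
  classical
  have hfin := fun α => children_finite G o α
  have hpar : ∀ β : G.edgeSet, ∃ α, level G o β ≠ 0 → β ∈ children G o α := fun β => by
    by_cases h : level G o β = 0
    · exact ⟨β, fun h' => absurd h h'⟩
    · obtain ⟨α, hα⟩ := exists_parent hG h
      exact ⟨α, fun _ => hα⟩
  choose par hpar using hpar
  choose off hoff using fun α : G.edgeSet => exists_partition_Ico (hfin α).toFinset hM
  -- `A n β` is the left endpoint for `β` computed by `n` steps of recursion through parents; it is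
  -- meaningful only when `n` is the level of `β`.
  let A : ℕ → G.edgeSet → ℝ := fun n => Nat.rec (motive := fun _ => G.edgeSet → ℝ) (fun _ => 0)
    (fun _ prev β => off (par β) (prev (par β)) β) n
  have ha : ∀ α, ∀ c ∈ children G o α,
      A (level G o c) c = off α (A (level G o α) α) c := by
    intro α c hc
    have h1 : par c = α := by
      have h2 := hpar c (by have := hc.2; omega)
      exact fin_injective (o := o) hG
        (((mem_children_iff hG).1 h2).symm.trans ((mem_children_iff hG).1 hc))
    rw [hc.2]
    change off (par c) (A (level G o α) (par c)) c = _
    rw [h1]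
  refine ⟨fun α => A (level G o α) α, fun α => ?_⟩
  obtain ⟨h1, h2, h3⟩ := hoff α (A (level G o α) α)
  rw [← finsum_mem_eq_finite_toFinset_sum _ (hfin α), ← hadd α] at h1 h2
  simp only [Finite.mem_toFinset] at h1 h2 h3
  refine ⟨fun c hc => ?_, fun t ht => ?_, fun t c hc d hd => ?_⟩
  · simp only [ha α c hc]
    exact h1 c hc
  · obtain ⟨c, hc, h⟩ := h2 t ht
    refine ⟨c, hc, ?_⟩
    simp only [ha α c hc]
    exact h
  · simp only [ha α c hc, ha α d hd]
    exact h3 t c hc d hd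

theorem exists_boundary_of_chain (hG : G.IsTree) (α : ℕ → G.edgeSet) (h0 : beg G o (α 0) = o)
    (hα : ∀ n, α (n + 1) ∈ children G o (α n)) :
    ∃ ζ : Boundary G o, bpred G o ζ = range α := by
  have hb : ∀ n, beg G o (α (n + 1)) = fin G o (α n) := fun n => (mem_children_iff hG).1 (hα n)
  have hd : ∀ n, G.dist o (beg G o (α n)) = n := by
    intro n
    induction n with
    | zero => rw [h0, SimpleGraph.dist_self]
    | succ n ih => rw [hb, dist_fin G o hG, ih]
  refine ⟨.ray (fun n => beg G o (α n)) h0 (fun n => ?_) (fun m n h => ?_), ?_⟩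
  · rw [hb]
    exact adj_beg_fin G o _
  · rw [← hd m, ← hd n]
    exact congrArg _ h
  · ext β
    simp only [bpred, hb, mk_beg_fin, mem_ofPred_eq, mem_range]
    exact exists_congr fun n => ⟨fun h => (Subtype.ext h).symm, fun h => congrArg _ h.symm⟩

/-- Each `t` in the root interval lies in the interval of exactly one child at every stage, hence
picks out a ray. The chain never stops: an edge without children has `M = 0` by forward additivity,
so its interval is empty. Leaves therefore carry no mass. -/
theorem exists_measure_tentBoundary [G.LocallyFinite] (hG : G.IsTree) {ω : G.edgeSet}
    (hω0 : beg G o ω = o) (hω : ∀ α, beg G o α = o → α = ω) {M : G.edgeSet → ℝ}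
    (hM : ∀ α, 0 ≤ M α) (hadd : ForwardAdditive G o M) :
    ∃ μ : Measure (Boundary G o), ∀ α, μ (tentBoundary G o α) = ENNReal.ofReal (M α) := by
  have := countable_edgeSet hG hω
  have := secondCountable_boundary (G := G) (o := o)
  obtain ⟨a, ha⟩ := exists_nested_Ico hG hM hadd
  set J : G.edgeSet → Set ℝ := fun α => Ico (a α) (a α + M α) with hJ
  have hchild : ∀ α, ∀ c ∈ children G o α, J c ⊆ J α := fun α => (ha α).1
  have hex : ∀ t : J ω, ∃ ζ : Boundary G o, ∀ α, α ∈ bpred G o ζ ↔ (t : ℝ) ∈ J α := by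
    rintro ⟨t, ht⟩
    choose next hnext hnextJ using fun α : {α // t ∈ J α} => (ha α).2.1 t α.2
    let s : ℕ → {α // t ∈ J α} := fun n => Nat.rec ⟨ω, ht⟩ (fun _ α => ⟨next α, hnextJ α⟩) n
    have hs : ∀ n, (s (n + 1)).1 ∈ children G o (s n).1 := fun n => hnext (s n)
    obtain ⟨ζ, hζ⟩ := exists_boundary_of_chain (o := o) hG (fun n => (s n).1) hω0 hs
    refine ⟨ζ, fun α => ?_⟩
    rw [hζ]
    constructor
    · rintro ⟨n, rfl⟩
      exact (s n).2
    -- Induction on the level: the chain contains every edge whose interval contains `t`.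
    · suffices h : ∀ n α, level G o α = n → t ∈ J α → α = (s n).1 from
        fun hα => ⟨level G o α, (h _ α rfl hα).symm⟩
      intro n
      induction n with
      | zero => exact fun α hl _ => eq_rootEdge hG hω hl
      | succ n ih =>
        intro β hl hβ
        obtain ⟨α, hα⟩ := exists_parent (o := o) hG (β := β) (by omega)
        have h1 := ih α (by have := hα.2; omega) (hchild α β hα hβ)
        rw [h1] at hα
        exact (ha _).2.2 t β hα _ (hnext (s n)) hβ (hnextJ (s n))
  choose Φ hΦ using hex
  have hpre : ∀ α, Φ ⁻¹' tentBoundary G o α = Subtype.val ⁻¹' J α := fun α => by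
    ext t
    exact hΦ t α
  have hmeas : Measurable Φ := by
    have hb : borel (Boundary G o) =
        MeasurableSpace.generateFrom (range (tentBoundary G o)) :=
      borel_eq_generateFrom_of_subbasis rfl
    change @Measurable _ _ _ (borel (Boundary G o)) Φ
    rw [hb]
    refine measurable_generateFrom ?_
    rintro _ ⟨α, rfl⟩
    rw [hpre]
    exact measurable_subtype_coe measurableSet_Ico
  have hsub : ∀ α, J α ⊆ J ω := by
    suffices h : ∀ n α, level G o α = n → J α ⊆ J ω from fun α => h _ α rfl
    intro n
    induction n with
    | zero => exact fun α hl => by rw [eq_rootEdge hG hω hl]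
    | succ n ih =>
      intro β hl
      obtain ⟨α, hα⟩ := exists_parent (o := o) hG (β := β) (by omega)
      exact (hchild α β hα).trans (ih α (by have := hα.2; omega))
  refine ⟨(volume.comap (Subtype.val : J ω → ℝ)).map Φ, fun α => ?_⟩
  rw [Measure.map_apply hmeas (isOpen_tentBoundary α).measurableSet, hpre,
    comap_subtype_coe_apply measurableSet_Ico, Subtype.image_preimage_coe,
    inter_eq_right.2 (hsub α), hJ, Real.volume_Ico, add_sub_cancel_left]

/-! ### Potentials and energies -/

theorem dualPow_of_nonneg {p : ℝ} (hp : 1 < p) {f : G.edgeSet → ℝ} {α : G.edgeSet}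
    (h : 0 ≤ f α) : dualPow G p f α = f α ^ (p.conjExponent - 1) := by
  have hq := (Real.HolderConjugate.conjExponent hp).symm.sub_one_ne_zero
  rcases h.eq_or_lt with h | h
  · simp [dualPow, ← h, Real.zero_rpow hq]
  · rw [dualPow, Real.sign_of_pos h, one_mul, abs_of_pos h]

theorem mul_rpow_sub_one {x q : ℝ} (hx : 0 ≤ x) (hq : 1 < q) : x * x ^ (q - 1) = x ^ q := by
  conv_lhs => rw [← Real.rpow_one x, ← Real.rpow_mul hx, one_mul]
  rw [← Real.rpow_add_of_nonneg hx zero_le_one (by linarith), add_sub_cancel]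

theorem nonneg_of_equilibriumEquation {p : ℝ} {M : G.edgeSet → ℝ}
    (hM : EquilibriumEquation G o p M)
    (hlt : ∀ x : V, vertexPotential G o (dualPow G p M) x < 1) (α : G.edgeSet) : 0 ≤ M α := by
  have h := (hM α).nonneg fun β => Real.rpow_nonneg (abs_nonneg _) _
  exact nonneg_of_mul_nonneg_left h (sub_pos.2 (hlt _))

theorem forwardAdditive_of_equilibriumEquation [G.LocallyFinite] (hG : G.IsTree) {p : ℝ}
    (hp : 1 < p) {M : G.edgeSet → ℝ} (hM : EquilibriumEquation G o p M)
    (hlt : ∀ x : V, vertexPotential G o (dualPow G p M) x < 1) : ForwardAdditive G o M := by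
  intro α
  have h0 := nonneg_of_equilibriumEquation hM hlt α
  have h1 := (hM α).unique (hasSum_tentEdges hG (F := fun β => |M β| ^ p.conjExponent)
    (S := fun c => M c * (1 - vertexPotential G o (dualPow G p M) (beg G o c))) fun c _ => hM c)
  have h2 : ∀ c ∈ children G o α,
      M c * (1 - vertexPotential G o (dualPow G p M) (beg G o c)) =
      M c * (1 - vertexPotential G o (dualPow G p M) (fin G o α)) := fun c hc => by
    rw [(mem_children_iff hG).1 hc]
  rw [finsum_mem_congr rfl h2, ← finsum_mem_mul M,
    abs_of_nonneg h0, ← mul_rpow_sub_one h0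
      ((Real.HolderConjugate.conjExponent hp).symm.lt), ← dualPow_of_nonneg hp h0] at h1
  -- The strict inequality `If < 1` at `e(α)` is what permits the cancellation.
  refine mul_right_cancel₀ (sub_pos.2 (hlt (fin G o α))).ne' ?_
  rw [← sub_eq_iff_eq_add'] at h1
  rw [← h1, vertexPotential_fin hG]
  ring

theorem boundaryPotential_eq_tsum (h : G.edgeSet → ℝ) (ζ : Boundary G o) :
    boundaryPotential G o h ζ = ∑' α, (tentBoundary G o α).indicator
      (fun _ => ENNReal.ofReal (h α)) ζ := by
  rw [boundaryPotential, tsum_subtype (bpred G o ζ) fun α => ENNReal.ofReal (h α)]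
  refine tsum_congr fun α => ?_
  by_cases hα : α ∈ bpred G o ζ
  · rw [indicator_of_mem hα, indicator_of_mem (show ζ ∈ tentBoundary G o α from hα)]
  · rw [indicator_of_notMem hα, indicator_of_notMem (show ζ ∉ tentBoundary G o α from hα)]

theorem measurable_boundaryPotential [Countable G.edgeSet] (h : G.edgeSet → ℝ) :
    Measurable (boundaryPotential G o h) := by
  rw [funext (boundaryPotential_eq_tsum h)]
  exact Measurable.tsum fun α =>
    measurable_const.indicator (isOpen_tentBoundary α).measurableSet

theorem lintegral_boundaryPotential [Countable G.edgeSet] (μ : Measure (Boundary G o))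
    (h : G.edgeSet → ℝ) : ∫⁻ ζ, boundaryPotential G o h ζ ∂μ =
      ∑' α, ENNReal.ofReal (h α) * μ (tentBoundary G o α) := by
  simp_rw [boundaryPotential_eq_tsum]
  rw [lintegral_tsum fun α =>
    (measurable_const.indicator (isOpen_tentBoundary α).measurableSet).aemeasurable]
  exact tsum_congr fun α => lintegral_indicator_const (isOpen_tentBoundary α).measurableSet _

theorem boundaryPotential_le_one (hG : G.IsTree) {f : G.edgeSet → ℝ} (hf : ∀ α, 0 ≤ f α)
    (hlt : ∀ x : V, vertexPotential G o f x < 1) (ζ : Boundary G o) :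
    boundaryPotential G o f ζ ≤ 1 := by
  classical
  rw [boundaryPotential, ENNReal.tsum_eq_iSup_sum]
  refine iSup_le fun s => ?_
  obtain ⟨x, hx⟩ := exists_subset_pred hG ζ (s.finite_toSet.image Subtype.val) (by
    rintro _ ⟨α, -, rfl⟩
    exact α.2)
  have hfin := pred_finite G o hG x
  rw [← ENNReal.ofReal_sum_of_nonneg fun (α : bpred G o ζ) _ => hf α, ← ENNReal.ofReal_one]
  refine ENNReal.ofReal_le_ofReal (le_trans ?_ (hlt x).le)
  rw [vertexPotential, finsum_mem_eq_finite_toFinset_sum _ hfin,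
    ← Finset.sum_image (s := s) (g := Subtype.val) (f := f) Subtype.val_injective.injOn]
  refine Finset.sum_le_sum_of_subset_of_nonneg (fun α hα => ?_) fun α _ _ => hf α
  rw [Finite.mem_toFinset]
  exact hx (by simpa using hα)

/-- Young's inequality, term by term, turns `m ≤ ∑ h M` into `m ≤ ‖h‖_p^p / p + m / p'`. Subtracting
the finite `m / p'` leaves `m / p ≤ ‖h‖_p^p / p`. -/
theorem le_lpPow_of_one_le_boundaryPotential [Countable G.edgeSet] {p : ℝ} (hp : 1 < p)
    {M h : G.edgeSet → ℝ} {m : ℝ} (hM : ∀ α, 0 ≤ M α) (hh : ∀ α, 0 ≤ h α)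
    (hsum : ∑' α, ENNReal.ofReal (M α ^ p.conjExponent) = ENNReal.ofReal m)
    {μ : Measure (Boundary G o)} (hμ : ∀ α, μ (tentBoundary G o α) = ENNReal.ofReal (M α))
    (hmass : μ univ = ENNReal.ofReal m) (hae : ∀ᵐ ζ ∂μ, 1 ≤ boundaryPotential G o h ζ) :
    ENNReal.ofReal m ≤ lpPow G p h := by
  have hpq := Real.HolderConjugate.conjExponent hp
  have h1 : ENNReal.ofReal m ≤ ∑' α, ENNReal.ofReal (h α) * ENNReal.ofReal (M α) := by
    calc ENNReal.ofReal m = ∫⁻ _, 1 ∂μ := by rw [lintegral_one, hmass]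
      _ ≤ ∫⁻ ζ, boundaryPotential G o h ζ ∂μ := lintegral_mono_ae hae
      _ = _ := by simp_rw [lintegral_boundaryPotential, hμ]
  have hterm : ∀ α, ENNReal.ofReal (h α) * ENNReal.ofReal (M α) ≤
      ENNReal.ofReal (|h α| ^ p) / ENNReal.ofReal p +
      ENNReal.ofReal (M α ^ p.conjExponent) / ENNReal.ofReal p.conjExponent := fun α => by
    have := ENNReal.young_inequality (ENNReal.ofReal (h α)) (ENNReal.ofReal (M α)) hpq
    rw [ENNReal.ofReal_rpow_of_nonneg (hh α) hpq.nonneg,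
      ENNReal.ofReal_rpow_of_nonneg (hM α) hpq.symm.nonneg] at this
    rwa [abs_of_nonneg (hh α)]
  have h2 : ENNReal.ofReal m ≤ lpPow G p h / ENNReal.ofReal p +
      ENNReal.ofReal m / ENNReal.ofReal p.conjExponent := by
    refine h1.trans ((ENNReal.tsum_le_tsum hterm).trans_eq ?_)
    simp only [ENNReal.tsum_add, div_eq_mul_inv, ENNReal.tsum_mul_right, hsum, lpPow]
  have h3 : ENNReal.ofReal m = ENNReal.ofReal m / ENNReal.ofReal p +
      ENNReal.ofReal m / ENNReal.ofReal p.conjExponent := by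
    rw [div_eq_mul_inv, div_eq_mul_inv, ← mul_add, hpq.inv_add_inv_ennreal, mul_one]
  have hfin : ENNReal.ofReal m / ENNReal.ofReal p.conjExponent ≠ ∞ :=
    ENNReal.div_ne_top ENNReal.ofReal_ne_top (ENNReal.ofReal_pos.2 hpq.symm.pos).ne'
  have h4 := (ENNReal.add_le_add_iff_right hfin).1 (h3.symm.trans_le h2)
  rwa [ENNReal.div_le_iff_le_mul (Or.inl (ENNReal.ofReal_pos.2 hpq.pos).ne')
    (Or.inl ENNReal.ofReal_ne_top), ENNReal.div_mul_cancel (ENNReal.ofReal_pos.2 hpq.pos).ne'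
    ENNReal.ofReal_ne_top] at h4

/-! ### Equilibrium measures -/

theorem exists_isFSigma_subset [Countable G.edgeSet] (hG : G.IsTree)
    (μ : Measure (Boundary G o)) [IsFiniteMeasure μ] {A : Set (Boundary G o)}
    (hA : MeasurableSet A) (hμ : μ Aᶜ = 0) : ∃ E, IsFSigma G o E ∧ E ⊆ A ∧ μ Eᶜ = 0 := by
  have := pseudoMetrizable_boundary (G := G) (o := o) hG
  -- For `n = 0` the bound is `∞`, which is harmless.
  have hK : ∀ n : ℕ, ∃ F, F ⊆ A ∧ IsClosed F ∧ μ (A \ F) < (n : ℝ≥0∞)⁻¹ := fun n =>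
    hA.exists_isClosed_sdiff_lt (measure_ne_top μ A) (ENNReal.inv_ne_zero.2 (ENNReal.natCast_ne_top n))
  choose K hKA hKc hKμ using hK
  refine ⟨⋃ n, K n, ⟨K, hKc, rfl⟩, iUnion_subset hKA, ?_⟩
  have h0 : μ (A \ ⋃ n, K n) = 0 := by
    refine le_antisymm (ge_of_tendsto' ENNReal.tendsto_inv_nat_nhds_zero fun n => ?_) zero_le
    exact (measure_mono (sdiff_subset_sdiff_right (subset_iUnion K n))).trans (hKμ n).le
  refine measure_mono_null (fun ζ hζ => ?_) (measure_union_null hμ h0)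
  by_cases h : ζ ∈ A
  · exact Or.inr ⟨h, hζ⟩
  · exact Or.inl h

/-- Here `M_p` itself lies in `Ω_E`, so it attains the infimum and neither the closure nor the
exceptional set plays a role. -/
theorem isEquilibriumMeasure_of_potential [Countable G.edgeSet] {p : ℝ} (hp : 1 < p)
    {M : G.edgeSet → ℝ} {m : ℝ} (hM : ∀ α, 0 ≤ M α)
    (hsum : ∑' α, ENNReal.ofReal (M α ^ p.conjExponent) = ENNReal.ofReal m)
    {μ : Measure (Boundary G o)} (hμ : ∀ α, μ (tentBoundary G o α) = ENNReal.ofReal (M α))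
    (hmass : μ univ = ENNReal.ofReal m) {E : Set (Boundary G o)}
    (hE : ∀ ζ ∈ E, 1 ≤ boundaryPotential G o (dualPow G p M) ζ) (hEμ : μ Eᶜ = 0) :
    IsEquilibriumMeasure G o p E μ := by
  have hco : coPotential G o μ = M := funext fun α => by
    rw [coPotential, hμ, ENNReal.toReal_ofReal (hM α)]
  have hf : ∀ α, 0 ≤ dualPow G p M α := fun α => by
    rw [dualPow_of_nonneg hp (hM α)]
    exact Real.rpow_nonneg (hM α) _
  have hlp : lpPow G p (dualPow G p M) = ENNReal.ofReal m := by
    rw [← hsum]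
    refine tsum_congr fun α => ?_
    rw [abs_of_nonneg (hf α), dualPow_of_nonneg hp (hM α), ← Real.rpow_mul (hM α),
      (Real.HolderConjugate.conjExponent hp).symm.sub_one_mul_conj]
  have hΩ : dualPow G p M ∈ Omega G o p E := ⟨hf, hlp ▸ ENNReal.ofReal_lt_top, hE⟩
  have hcap : capacity G o p E = ENNReal.ofReal m := by
    refine le_antisymm ((iInf₂_le _ hΩ).trans_eq hlp) (le_iInf₂ fun h hh => ?_)
    refine le_lpPow_of_one_le_boundaryPotential hp hM hh.1 hsum hμ hmass ?_
    exact measure_mono_null (compl_subset_compl.2 fun ζ hζ => hh.2.2 ζ hζ) hEμ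
  have hp0 : p ≠ 0 := by linarith
  have hzero : lpPow G p (0 : G.edgeSet → ℝ) = 0 := by
    simp [lpPow, Real.zero_rpow hp0]
  refine ⟨⟨hmass ▸ ENNReal.ofReal_lt_top⟩,
    measure_mono_null (compl_subset_compl.2 subset_closure) hEμ, ?_, ?_, hmass.trans hcap.symm⟩
  · rw [hco]
    refine ⟨⟨hlp ▸ ENNReal.ofReal_lt_top, fun ε hε => ⟨_, hΩ, ?_⟩⟩, hlp.trans hcap.symm⟩
    rwa [sub_self, hzero]
  · rw [hco, ← nonpos_iff_eq_zero, ← hzero]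
    -- The exceptional set is empty, so the zero function is admissible for it.
    refine iInf₂_le _ ⟨fun _ => le_rfl, hzero ▸ ENNReal.zero_lt_top, ?_⟩
    exact fun ζ hζ => absurd (hE ζ hζ.1) (not_le.2 hζ.2)

theorem exists_isEquilibriumMeasure [G.LocallyFinite] (hG : G.IsTree) (ho : ∃! y, G.Adj o y)
    {p : ℝ} (hp : 1 < p) {M : G.edgeSet → ℝ} (hM : EquilibriumEquation G o p M)
    (hlt : ∀ x : V, vertexPotential G o (dualPow G p M) x < 1) :
    ∃ μ : Measure (Boundary G o), IsFiniteMeasure μ ∧ (∀ α, M α = coPotential G o μ α) ∧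
      ∃ E : Set (Boundary G o), IsFSigma G o E ∧ IsEquilibriumMeasure G o p E μ := by
  obtain ⟨ω, hω0, hω⟩ := exists_rootEdge hG ho
  have := countable_edgeSet hG hω
  have h0 := nonneg_of_equilibriumEquation hM hlt
  have hf : ∀ α, 0 ≤ dualPow G p M α := fun α => by
    rw [dualPow_of_nonneg hp (h0 α)]
    exact Real.rpow_nonneg (h0 α) _
  obtain ⟨μ, hμ⟩ := exists_measure_tentBoundary hG hω0 hω h0
    (forwardAdditive_of_equilibriumEquation hG hp hM hlt)
  have hmass : μ univ = ENNReal.ofReal (M ω) := by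
    rw [← tentBoundary_rootEdge hG hω, hμ]
  have hfin : IsFiniteMeasure μ := ⟨hmass ▸ ENNReal.ofReal_lt_top⟩
  have hsum : ∑' α, ENNReal.ofReal (M α ^ p.conjExponent) = ENNReal.ofReal (M ω) := by
    have h1 := hM ω
    rw [hω0, vertexPotential_root hG, sub_zero, mul_one] at h1
    replace h1 := (hasSum_subtype_iff_indicator (f := fun β => |M β| ^ p.conjExponent)).1 h1
    rw [tentEdges_rootEdge hG hω, indicator_univ] at h1
    simp only [abs_of_nonneg (h0 _)] at h1
    rw [← h1.tsum_eq, ENNReal.ofReal_tsum_of_nonneg (fun α => Real.rpow_nonneg (h0 α) _)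
      h1.summable]
  have hint : ∫⁻ ζ, boundaryPotential G o (dualPow G p M) ζ ∂μ = ∫⁻ _, 1 ∂μ := by
    rw [lintegral_boundaryPotential, lintegral_one, hmass, ← hsum]
    refine tsum_congr fun α => ?_
    rw [hμ, ← ENNReal.ofReal_mul (hf α), dualPow_of_nonneg hp (h0 α), mul_comm,
      mul_rpow_sub_one (h0 α) (Real.HolderConjugate.conjExponent hp).symm.lt]
  -- The potential is at most `1` and has the same finite integral as `1`.
  have hae : boundaryPotential G o (dualPow G p M) =ᵐ[μ] fun _ => 1 :=
    ae_eq_of_ae_le_of_lintegral_le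
      (ae_of_all _ (boundaryPotential_le_one hG hf hlt))
      (by rw [hint, lintegral_one]; exact measure_ne_top μ _) aemeasurable_const hint.ge
  obtain ⟨E, hE, hsub, hEμ⟩ := exists_isFSigma_subset hG μ
    (A := {ζ | boundaryPotential G o (dualPow G p M) ζ = 1})
    (measurable_boundaryPotential _ (measurableSet_singleton 1)) hae
  refine ⟨μ, hfin, fun α => ?_, E, hE,
    isEquilibriumMeasure_of_potential hp h0 hsum hμ hmass (fun ζ hζ => (hsub hζ).ge) hEμ⟩
  rw [coPotential, hμ, ENNReal.toReal_ofReal (h0 α)]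

/-! ### Vertex functions -/

theorem sign_mul_rpow_neg (x r : ℝ) :
    Real.sign (-x) * |(-x)| ^ r = -(Real.sign x * |x| ^ r) := by
  rw [Real.sign_neg, abs_neg, neg_mul]

theorem abs_sign_mul_rpow {r : ℝ} (hr : r ≠ 0) (x : ℝ) :
    |Real.sign x * |x| ^ r| = |x| ^ r := by
  rcases lt_trichotomy x 0 with h | rfl | h
  · rw [Real.sign_of_neg h, neg_one_mul, abs_neg, abs_of_nonneg (Real.rpow_nonneg (abs_nonneg _) _)]
  · simp [Real.zero_rpow hr]
  · rw [Real.sign_of_pos h, one_mul, abs_of_nonneg (Real.rpow_nonneg (abs_nonneg _) _)]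

theorem sign_sign_mul_rpow {r : ℝ} (x : ℝ) : Real.sign (Real.sign x * |x| ^ r) = Real.sign x := by
  rcases lt_trichotomy x 0 with h | rfl | h
  · have := Real.rpow_pos_of_pos (abs_pos.2 h.ne) r
    rw [Real.sign_of_neg h, Real.sign_of_neg (by linarith)]
  · simp
  · have := Real.rpow_pos_of_pos (abs_pos.2 h.ne') r
    rw [Real.sign_of_pos h, Real.sign_of_pos (by linarith)]

theorem conjExponent_conjExponent {p : ℝ} (hp : 1 < p) : p.conjExponent.conjExponent = p :=
  (Real.HolderConjugate.conjExponent hp).symm.conjExponent_eq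

theorem abs_dualPow_conjExponent_rpow {p : ℝ} (hp : 1 < p) (f : G.edgeSet → ℝ) (α : G.edgeSet) :
    |dualPow G p.conjExponent f α| ^ p.conjExponent = |f α| ^ p := by
  have hpq := Real.HolderConjugate.conjExponent hp
  rw [dualPow, conjExponent_conjExponent hp, abs_sign_mul_rpow hpq.sub_one_ne_zero,
    ← Real.rpow_mul (abs_nonneg _), hpq.sub_one_mul_conj]

theorem dualPow_dualPow_conjExponent {p : ℝ} (hp : 1 < p) (f : G.edgeSet → ℝ) :
    dualPow G p (dualPow G p.conjExponent f) = f := by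
  have hpq := Real.HolderConjugate.conjExponent hp
  -- This identity makes the two signed powers mutually inverse.
  have h1 : (p - 1) * (p.conjExponent - 1) = 1 := by
    have := hpq.mul_eq_add
    linarith
  ext α
  rw [dualPow, dualPow, conjExponent_conjExponent hp, sign_sign_mul_rpow,
    abs_sign_mul_rpow hpq.sub_one_ne_zero, ← Real.rpow_mul (abs_nonneg _), h1, Real.rpow_one]
  rcases lt_trichotomy (f α) 0 with h | h | h
  · rw [Real.sign_of_neg h, abs_of_neg h, neg_mul_neg, one_mul]
  · simp [h]
  · rw [Real.sign_of_pos h, abs_of_pos h, one_mul]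

theorem vertexPotential_grad (hG : G.IsTree) {g : V → ℝ} (hg : g o = 0) :
    vertexPotential G o (grad G o g) = g := by
  ext x
  induction x using vertex_induction (o := o) hG with
  | h0 => rw [vertexPotential_root hG, hg]
  | h1 α ih => rw [vertexPotential_fin hG, ih, grad, add_sub_cancel]

theorem equilibriumEquation_of_vertexEquilibriumEquation (hG : G.IsTree) {p : ℝ} (hp : 1 < p)
    {g : V → ℝ} (hg : g o = 0) (h : VertexEquilibriumEquation G o p g) :
    EquilibriumEquation G o p (dualPow G p.conjExponent (grad G o g)) := by
  intro α
  simp only [abs_dualPow_conjExponent_rpow hp, dualPow_dualPow_conjExponent hp,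
    vertexPotential_grad hG hg]
  exact h α

/-- The neighbours of `e(α)` are `b(α)` and the ends of the children of `α`. In the Laplacian the
first contributes `-(∇g)_{p'}(α)` and the others `(∇g)_{p'}(c)`. -/
theorem pHarmonic_of_forwardAdditive [G.LocallyFinite] (hG : G.IsTree) {p : ℝ} (hp : 1 < p)
    {g : V → ℝ} (h : ForwardAdditive G o (dualPow G p.conjExponent (grad G o g))) :
    PHarmonic G o p g := by
  classical
  intro x hx
  obtain ⟨α, rfl⟩ := exists_fin_eq hG hx
  have hfin := children_finite G o α
  have hα := h α
  rw [finsum_mem_eq_finite_toFinset_sum _ hfin] at hα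
  have hnb : G.neighborFinset (fin G o α) =
      insert (beg G o α) (hfin.toFinset.image (fin G o)) := by
    ext y
    simp only [SimpleGraph.mem_neighborFinset, Finset.mem_insert, Finset.mem_image,
      Finite.mem_toFinset, mem_children_iff hG]
    constructor
    · intro hy
      rcases hG.dist_eq_dist_add_one_of_adj o hy with hd | hd
      · obtain ⟨β, hb, hf⟩ := exists_edge_of_adj hG hy.symm hd
        rw [← hb, fin_injective hG hf]
        exact Or.inl rfl
      · exact Or.inr (exists_edge_of_adj hG hy hd)
    · rintro (rfl | ⟨c, hc, rfl⟩)
      · exact (adj_beg_fin G o α).symm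
      · rw [← hc]
        exact adj_beg_fin G o c
  have hnot : beg G o α ∉ hfin.toFinset.image (fin G o) := by
    simp only [Finset.mem_image, Finite.mem_toFinset, mem_children_iff hG]
    rintro ⟨c, hc, h1⟩
    have h2 := dist_fin G o hG c
    rw [h1, hc, dist_fin G o hG] at h2
    omega
  rw [pLaplacian, hnb, Finset.sum_insert hnot, Finset.sum_image (fin_injective hG).injOn]
  have h1 : g (beg G o α) - g (fin G o α) = -grad G o g α := by
    rw [grad, neg_sub]
  have h2 : ∀ c ∈ hfin.toFinset,
      Real.sign (g (fin G o c) - g (fin G o α)) * |g (fin G o c) - g (fin G o α)| ^ (p - 1) =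
      dualPow G p.conjExponent (grad G o g) c := fun c hc => by
    rw [Finite.mem_toFinset, mem_children_iff hG] at hc
    rw [dualPow, conjExponent_conjExponent hp, grad, hc]
  rw [Finset.sum_congr rfl h2, ← hα, h1, sign_mul_rpow_neg, dualPow,
    conjExponent_conjExponent hp, neg_add_cancel]

end RootedTree

theorem mainTheorem2 {V : Type*} (G : SimpleGraph V) [G.LocallyFinite] (hG : G.IsTree)
    (o : V) (ho : ∃! y, G.Adj o y) (p : ℝ) (hp : 1 < p) :
    (∀ M : G.edgeSet → ℝ,
      RootedTree.EquilibriumEquation G o p M →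
      (∀ x : V, RootedTree.vertexPotential G o (RootedTree.dualPow G p M) x < 1) →
      RootedTree.ForwardAdditive G o M ∧
      ∃ μ : MeasureTheory.Measure (RootedTree.Boundary G o),
        MeasureTheory.IsFiniteMeasure μ ∧
        (∀ α, M α = RootedTree.coPotential G o μ α) ∧
        ∃ E : Set (RootedTree.Boundary G o),
          RootedTree.IsFSigma G o E ∧ RootedTree.IsEquilibriumMeasure G o p E μ) ∧
    (∀ g : V → ℝ,
      g o = 0 →
      (∀ x : V, g x < 1) →
      RootedTree.VertexEquilibriumEquation G o p g →
      RootedTree.PHarmonic G o p g ∧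
      ∃ μ : MeasureTheory.Measure (RootedTree.Boundary G o),
        MeasureTheory.IsFiniteMeasure μ ∧
        (∀ α, RootedTree.dualPow G p.conjExponent (RootedTree.grad G o g) α =
          RootedTree.coPotential G o μ α) ∧
        ∃ E : Set (RootedTree.Boundary G o),
          RootedTree.IsFSigma G o E ∧ RootedTree.IsEquilibriumMeasure G o p E μ) := by
  refine ⟨fun M hM hlt => ⟨RootedTree.forwardAdditive_of_equilibriumEquation hG hp hM hlt,
    RootedTree.exists_isEquilibriumMeasure hG ho hp hM hlt⟩, fun g hg hlt hM => ?_⟩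
  have hM' := RootedTree.equilibriumEquation_of_vertexEquilibriumEquation hG hp hg hM
  have hlt' : ∀ x : V, RootedTree.vertexPotential G o (RootedTree.dualPow G p
      (RootedTree.dualPow G p.conjExponent (RootedTree.grad G o g))) x < 1 := by
    rw [RootedTree.dualPow_dualPow_conjExponent hp, RootedTree.vertexPotential_grad hG hg]
    exact hlt
  exact ⟨RootedTree.pHarmonic_of_forwardAdditive hG hp
    (RootedTree.forwardAdditive_of_equilibriumEquation hG hp hM' hlt'),
    RootedTree.exists_isEquilibriumMeasure hG ho hp hM' hlt'⟩
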